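/- **Setting.** Let $\mathcal S,\mathcal A$ be standard Borel spaces (states, actions), $\rho$ an initial distribution on $\mathcal S$, $\mathcal P(\cdot\mid s,a)$ a transition kernel and $\gamma\in(0,1)$. Let $\mathcal T$ be a probability distribution over tasks $\mathcal M=(\mathcal S,\mathcal A,\mathcal P,\mathcal R_{\mathcal M},\gamma)$, labelled by a standard Borel space, which share everything except the reward $\mathcal R_{\mathcal M}(s,a)\in\mathbb R$; the reward is jointly measurable in $(\mathcal M,s,a)$, and $|\mathcal R_{\mathcal M}(s,a)|\le B(\mathcal M)$ with $\mathbb E_{\mathcal M\sim\mathcal T}[B(\mathcal M)]<\infty$. Let $\mathcal L=\bigcup_{t\ge1}\mathcal L_t$ with $\mathcal L_t=(\mathcal S\times\mathcal A\times\mathbb R)^{t-1}\times\mathcal S$ be the set of partial trajectories, and let $\Pi_3$ be the set of (measurable) policies $\pi:\mathcal L\to\Delta(\mathcal A)$. Each task $\mathcal M$ induces an MDP $\tilde{\mathcal M}$ with state space $\mathcal L$: in state $l=(s_1,a_1,r_1,\dots,s_t)$, the action $a_t$ gives the reward $r_t=\mathcal R_{\mathcal M}(s_t,a_t)$ and leads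 to the state $(s_1,a_1,r_1,\dots,s_t,a_t,r_t,s_{t+1})$ with $s_{t+1}\sim\mathcal P(\cdot\mid s_t,a_t)$; its initial state is $l=(s_1)$ with $s_1\sim\rho$. For $\pi\in\Pi_3$ let $J_{\mathcal M}(\pi)$ be the expected discounted return $\mathbb E\big[\sum_{k\ge0}\gamma^k\,\mathcal R_{\mathcal M}(s_{k+1},a_{k+1})\big]$ of $\pi$ in $\tilde{\mathcal M}$, let $Q^*_{\mathcal M}(l,a)$ be the maximum over $\pi\in\Pi_3$ of the expected discounted return in $\tilde{\mathcal M}$ when starting in $l$ with the action $a$ and following $\pi$ afterwards, and let $J^*_{\mathcal T}=\mathbb E_{\mathcal M\sim\mathcal T}[\max_{\pi\in\Pi_3}J_{\mathcal M}(\pi)]$. Assume that the maxima over policies exist: every task $\mathcal M$ has an optimal policy $\pi^*_{\mathcal M}\in\Pi_3$, i.e. one that maximizes the expected discounted return in $\tilde{\mathcal M}$ from every $l\in\mathcal L$, and $\pi^*_{\mathcal M}(\cdot\mid l)$ depends measurably on $(\mathcal M,l)$. For $\pi\in\Pi_3$ let $d_{\tilde{\mathcal M},\pi}=(1-\gamma)\sum_{k\ge0}\gamma^k\,\mathbb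 P(l_k\in\cdot)$ be the normalized discounted occupancy on $\mathcal L$, where $l_0,l_1,\dots$ are the states visited by $\pi$ in $\tilde{\mathcal M}$. Let $p(l)=\mathbb E_{\mathcal M\sim\mathcal T}[d_{\tilde{\mathcal M},\pi}(l)]$, a probability distribution on $\mathcal L$, and let the task posterior $p(\mathcal M\mid l)$ be the conditional distribution of $\mathcal M$ given $l$ under the joint law $\mathcal T(d\mathcal M)\,d_{\tilde{\mathcal M},\pi}(dl)$. **Theorem.** For every $\pi\in\Pi_3$, all the expectations below are well defined and finite (those over the posterior for $p$-almost every $l$), and $$ \begin{aligned} J^*_{\mathcal T}-\mathbb E_{\mathcal M\sim\mathcal T}[J_{\mathcal M}(\pi)] &=\frac1{1-\gamma}\int_{\mathcal L}p(dl)\left[\int p(d\mathcal M\mid l)\,\max_a Q^*_{\mathcal M}(l,a)-\int \pi(da\mid l)\,p(d\mathcal M\mid l)\,Q^*_{\mathcal M}(l,a)\right]\\ &\ge\frac1{1-\gamma}\int_{\mathcal L}p(dl)\left[\int p(d\mathcal M\mid l)\,\max_a Q^*_{\mathcal M}(l,a)-\sup_a\int p(d\mathcal M\mid l)\,Q^*_{\mathcal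 M}(l,a)\right]. \end{aligned} $$ -/

import Mathlib

open MeasureTheory ProbabilityTheory
open scoped ENNReal

noncomputable section

universe u v w

/-- A discounted Markov decision process with state space `X` and action space `A`. -/
structure MDP (X : Type u) (A : Type v) [MeasurableSpace X] [MeasurableSpace A] where
  trans : Kernel (X × A) X
  isMarkov : IsMarkovKernel trans
  reward : X → A → ℝ
  measurable_reward : Measurable (Function.uncurry reward)
  γ : ℝ
  γ_pos : 0 < γ
  γ_lt_one : γ < 1

attribute [instance] MDP.isMarkov

/-- Randomized policies `X → Δ(A)`. -/
abbrev Policy (X : Type u) (A : Type v) [MeasurableSpace X] [MeasurableSpace A] :=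
  {π : Kernel X A // IsMarkovKernel π}

namespace MDP

variable {X : Type u} {A : Type v} [MeasurableSpace X] [MeasurableSpace A]

/-- One step of the state-action chain: `x' ∼ trans (x, a)`, then `a' ∼ π x'`. -/
def step (M : MDP X A) (π : Kernel X A) : Kernel (X × A) (X × A) :=
  (Kernel.id ×ₖ π) ∘ₖ M.trans

instance (M : MDP X A) (π : Kernel X A) [IsMarkovKernel π] : IsMarkovKernel (M.step π) := by
  unfold step; infer_instance

/-- Law of the infinite state-action trajectory when `(x₀, a₀) ∼ μ` and the later actions are
drawn from `π`. -/
def pathLaw (M : MDP X A) (π : Kernel X A) [IsMarkovKernel π] (μ : Measure (X × A)) :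
    Measure (ℕ → X × A) :=
  Kernel.trajMeasure (X := fun _ => X × A) μ
    (fun n => (M.step π).comap (fun h => h ⟨n, Finset.mem_Iic.2 le_rfl⟩) (measurable_pi_apply _))

/-- The discounted return `∑ₜ γᵗ rₜ` of a trajectory. -/
def discountedReturn (M : MDP X A) (ω : ℕ → X × A) : ℝ :=
  ∑' t, M.γ ^ t * M.reward (ω t).1 (ω t).2

/-- Expected discounted return of `π` from the initial state distribution `ρ`. -/
def J (M : MDP X A) (ρ : Measure X) (π : Kernel X A) [IsMarkovKernel π] : ℝ :=
  ∫ ω, M.discountedReturn ω ∂(M.pathLaw π (ρ ⊗ₘ π))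

/-- State value function of `π`. -/
def V (M : MDP X A) (π : Kernel X A) [IsMarkovKernel π] (x : X) : ℝ :=
  M.J (Measure.dirac x) π

/-- State-action value function of `π`. -/
def Q (M : MDP X A) (π : Kernel X A) [IsMarkovKernel π] (x : X) (a : A) : ℝ :=
  ∫ ω, M.discountedReturn ω ∂(M.pathLaw π (Measure.dirac (x, a)))

/-- Optimal state-action value function. -/
def Qstar (M : MDP X A) (x : X) (a : A) : ℝ :=
  ⨆ π : Policy X A, haveI := π.2; M.Q π.1 x a

/-- Optimal return from the initial state distribution `ρ`. -/
def Jstar (M : MDP X A) (ρ : Measure X) : ℝ :=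
  ⨆ π : Policy X A, haveI := π.2; M.J ρ π.1

/-- `π` attains the maximal value simultaneously at every state. -/
def IsOptimal (M : MDP X A) (π : Kernel X A) [IsMarkovKernel π] : Prop :=
  ∀ π' : Policy X A, haveI := π'.2; ∀ x, M.V π'.1 x ≤ M.V π x

/-- Law of the state `xₜ` when `x₀ ∼ ρ` and all actions are drawn from `π`. -/
def stateLaw (M : MDP X A) (ρ : Measure X) (π : Kernel X A) [IsMarkovKernel π] (t : ℕ) :
    Measure X :=
  (M.pathLaw π (ρ ⊗ₘ π)).map (fun ω => (ω t).1)

/-- Normalized discounted state occupancy `(1 - γ) ∑ₜ γᵗ ℙ(xₜ ∈ ·)`. -/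
def occupancy (M : MDP X A) (ρ : Measure X) (π : Kernel X A) [IsMarkovKernel π] : Measure X :=
  Measure.sum fun t => ENNReal.ofReal ((1 - M.γ) * M.γ ^ t) • M.stateLaw ρ π t

instance (M : MDP X A) (π : Kernel X A) [IsMarkovKernel π] (μ : Measure (X × A))
    [IsProbabilityMeasure μ] : IsProbabilityMeasure (M.pathLaw π μ) := by
  unfold pathLaw; infer_instance

instance (M : MDP X A) (ρ : Measure X) [IsProbabilityMeasure ρ] (π : Kernel X A)
    [IsMarkovKernel π] (t : ℕ) : IsProbabilityMeasure (M.stateLaw ρ π t) :=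
  Measure.isProbabilityMeasure_map
    (measurable_fst.comp (measurable_pi_apply t)).aemeasurable

lemma tsum_occupancy_weights (M : MDP X A) :
    ∑' t, ENNReal.ofReal ((1 - M.γ) * M.γ ^ t) = 1 := by
  have h0 := M.γ_pos.le
  have h1 : 0 ≤ 1 - M.γ := by linarith [M.γ_lt_one]
  rw [← ENNReal.ofReal_tsum_of_nonneg (fun t => by positivity)
    ((summable_geometric_of_lt_one h0 M.γ_lt_one).mul_left _), tsum_mul_left,
    tsum_geometric_of_lt_one h0 M.γ_lt_one, mul_inv_cancel₀ (by linarith [M.γ_lt_one]),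
    ENNReal.ofReal_one]

instance (M : MDP X A) (ρ : Measure X) [IsProbabilityMeasure ρ] (π : Kernel X A)
    [IsMarkovKernel π] : IsProbabilityMeasure (M.occupancy ρ π) := by
  constructor
  simp only [occupancy, Measure.sum_apply _ MeasurableSet.univ, Measure.smul_apply,
    measure_univ, smul_eq_mul, mul_one]
  exact M.tsum_occupancy_weights

lemma pathLaw_map_zero (M : MDP X A) (π : Kernel X A) [IsMarkovKernel π] (μ : Measure (X × A))
    [IsProbabilityMeasure μ] : (M.pathLaw π μ).map (fun ω => ω 0) = μ := by
  have h : Measurable fun h : (i : Finset.Iic 0) → X × A => h ⟨0, by simp⟩ :=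
    measurable_pi_apply _
  have e : (fun ω : ℕ → X × A => ω 0) =
      (fun h : (i : Finset.Iic 0) → X × A => h ⟨0, by simp⟩) ∘ Preorder.frestrictLe 0 := rfl
  rw [e, ← Measure.map_map h (by fun_prop), pathLaw, Kernel.trajMeasure,
    Measure.map_comp _ _ (by fun_prop), Kernel.traj_map_frestrictLe, Kernel.partialTraj_self,
    Measure.id_comp, Measure.map_map h (by fun_prop)]
  exact Measure.map_id

lemma pathLaw_map_succ (M : MDP X A) (π : Kernel X A) [IsMarkovKernel π] (μ : Measure (X × A))
    [IsProbabilityMeasure μ] (t : ℕ) :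
    (M.pathLaw π μ).map (fun ω => ω (t + 1)) =
      ((M.pathLaw π μ).map (fun ω => ω t)).bind (M.step π) := by
  have key := Kernel.map_frestrictLe_trajMeasure_compProd_eq_map_trajMeasure
    (X := fun _ => X × A) (μ₀ := μ) (a := t)
    (κ := fun n => (M.step π).comap (fun h => h ⟨n, Finset.mem_Iic.2 le_rfl⟩)
      (measurable_pi_apply _))
  have key2 := congrArg Measure.snd key
  rw [Measure.snd_compProd] at key2
  change _ = ((M.pathLaw π μ).map _).map Prod.snd at key2
  rw [Measure.map_map measurable_snd (by fun_prop)] at key2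
  change _ = (M.pathLaw π μ).map (fun ω => ω (t + 1)) at key2
  rw [← key2]
  have e : (fun ω : ℕ → X × A => ω t) =
      (fun h : (i : Finset.Iic t) → X × A => h ⟨t, Finset.mem_Iic.2 le_rfl⟩) ∘
        Preorder.frestrictLe t := rfl
  rw [e, ← Measure.map_map (measurable_pi_apply _) (by fun_prop)]
  ext B hB
  rw [Measure.bind_apply hB (Kernel.aemeasurable _), Measure.bind_apply hB (Kernel.aemeasurable _),
    lintegral_map (Kernel.measurable_coe _ hB) (measurable_pi_apply _)]
  rfl

end MDP

/-- Partial trajectories `(s₀, a₀, r₀, …, sₜ)`: the disjoint union over `t` of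
`(S × A × ℝ)ᵗ × S`. -/
abbrev PartialTraj (S : Type u) (A : Type v) := Σ t : ℕ, (Fin t → S × A × ℝ) × S

namespace PartialTraj

variable {S : Type u} {A : Type v} [MeasurableSpace S] [MeasurableSpace A]

/-- The partial trajectory consisting of one state. -/
def start (s : S) : PartialTraj S A := ⟨0, Fin.elim0, s⟩

/-- The current (last) state. -/
def last (l : PartialTraj S A) : S := l.2.2

/-- Extend a partial trajectory by an action, a reward and the next state. -/
def extend (l : PartialTraj S A) (a : A) (r : ℝ) (s' : S) : PartialTraj S A :=
  ⟨l.1 + 1, Fin.snoc (α := fun _ => S × A × ℝ) l.2.1 (l.last, a, r), s'⟩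

lemma measurable_mk (t : ℕ) :
    Measurable (fun y : (Fin t → S × A × ℝ) × S => (⟨t, y⟩ : PartialTraj S A)) :=
  fun _ hB => MeasurableSpace.measurableSet_iInf.1 hB t

/-- A function of a partial trajectory and a parameter is measurable if it is so on trajectories
of each fixed length. -/
lemma measurable_of_mk {Y Z : Type*} [MeasurableSpace Y] [MeasurableSpace Z]
    {f : PartialTraj S A × Y → Z}
    (hf : ∀ t, Measurable fun x : ((Fin t → S × A × ℝ) × S) × Y => f (⟨t, x.1⟩, x.2)) :
    Measurable f := by
  have hinj : ∀ t, Function.Injective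
      (fun y : (Fin t → S × A × ℝ) × S => (⟨t, y⟩ : PartialTraj S A)) :=
    fun t y z h => eq_of_heq (Sigma.mk.inj h).2
  have hemb : ∀ t, MeasurableEmbedding
      (fun y : (Fin t → S × A × ℝ) × S => (⟨t, y⟩ : PartialTraj S A)) := fun t =>
    { injective := hinj t
      measurable := measurable_mk t
      measurableSet_image' := fun B hB => MeasurableSpace.measurableSet_iInf.2 fun t' => by
        change MeasurableSet ((fun y => (⟨t', y⟩ : PartialTraj S A)) ⁻¹'
          ((fun y => (⟨t, y⟩ : PartialTraj S A)) '' B))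
        by_cases h : t' = t
        · subst h
          rwa [Set.preimage_image_eq _ (hinj t')]
        · convert MeasurableSet.empty
          ext y
          simp only [Set.mem_preimage, Set.mem_image, Set.mem_empty_iff_false, iff_false]
          rintro ⟨z, _, hz⟩
          exact h (congrArg Sigma.fst hz).symm }
  intro B hB
  have : f ⁻¹' B = ⋃ t, Prod.map (Sigma.mk t) id ''
      ((fun x : ((Fin t → S × A × ℝ) × S) × Y => f (⟨t, x.1⟩, x.2)) ⁻¹' B) := by
    ext ⟨⟨t, y⟩, z⟩
    simp only [Set.mem_preimage, Set.mem_iUnion, Set.mem_image]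
    constructor
    · intro h
      exact ⟨t, (y, z), h, rfl⟩
    · rintro ⟨t', x, hx, he⟩
      rw [← he]
      exact hx
  rw [this]
  exact MeasurableSet.iUnion fun t =>
    ((hemb t).prodMap MeasurableEmbedding.id).measurableSet_image' (hf t hB)

lemma measurable_start : Measurable (start : S → PartialTraj S A) :=
  (measurable_mk 0).comp (measurable_const.prodMk measurable_id)

lemma measurable_last : Measurable (last : PartialTraj S A → S) :=
  (measurable_of_mk (Y := Unit) (f := fun x => last x.1)
    fun _ => measurable_snd.comp measurable_fst).comp (measurable_id.prodMk
      (measurable_const (a := ())))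

lemma measurable_extend :
    Measurable fun x : PartialTraj S A × A × ℝ × S => extend x.1 x.2.1 x.2.2.1 x.2.2.2 := by
  refine measurable_of_mk fun t => (measurable_mk (t + 1)).comp (Measurable.prodMk ?_ (by fun_prop))
  refine measurable_pi_lambda _ fun i => ?_
  refine Fin.lastCases ?_ (fun j => ?_) i
  · simp only [Fin.snoc_last, last]
    fun_prop
  · simp only [Fin.snoc_castSucc]
    fun_prop

end PartialTraj

/-- The MDP on partial trajectories induced by `M`: in state `l`, the action `a` yields the reward
`r = R(last l, a)`, and the next state is `l` extended by `a`, `r` and `s' ∼ P(· | last l, a)`. -/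
def MDP.augment {S : Type u} {A : Type v} [MeasurableSpace S] [MeasurableSpace A]
    (M : MDP S A) : MDP (PartialTraj S A) A where
  trans := (Kernel.id ×ₖ M.trans.comap (fun x : PartialTraj S A × A => (x.1.last, x.2))
      (by have := PartialTraj.measurable_last (S := S) (A := A); fun_prop)).map
    (fun y : (PartialTraj S A × A) × S =>
      y.1.1.extend y.1.2 (M.reward y.1.1.last y.1.2) y.2)
  isMarkov := by
    have h1 := PartialTraj.measurable_last (S := S) (A := A)
    have h2 := PartialTraj.measurable_extend (S := S) (A := A)
    have h3 := M.measurable_reward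
    refine Kernel.IsMarkovKernel.map _ (h2.comp (f := fun y : (PartialTraj S A × A) × S =>
      (y.1.1, y.1.2, M.reward y.1.1.last y.1.2, y.2)) ?_)
    have h4 : Measurable fun y : (PartialTraj S A × A) × S => M.reward y.1.1.last y.1.2 :=
      h3.comp ((h1.comp (by fun_prop)).prodMk (by fun_prop))
    fun_prop
  reward l a := M.reward l.last a
  measurable_reward :=
    M.measurable_reward.comp
      ((PartialTraj.measurable_last.comp measurable_fst).prodMk measurable_snd)
  γ := M.γ
  γ_pos := M.γ_pos
  γ_lt_one := M.γ_lt_one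

/-- A distribution over tasks sharing the states, actions, initial distribution, dynamics and
discount factor. Tasks are labelled by `Θ`; task `θ` has reward function `reward θ`. -/
structure TaskDistribution (Θ : Type w) (S : Type u) (A : Type v)
    [MeasurableSpace Θ] [MeasurableSpace S] [MeasurableSpace A] where
  prior : Measure Θ
  isProb_prior : IsProbabilityMeasure prior
  init : Measure S
  isProb_init : IsProbabilityMeasure init
  trans : Kernel (S × A) S
  isMarkov : IsMarkovKernel trans
  reward : Θ → S → A → ℝ
  measurable_reward : Measurable fun x : Θ × S × A => reward x.1 x.2.1 x.2.2
  γ : ℝ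
  γ_pos : 0 < γ
  γ_lt_one : γ < 1

attribute [instance] TaskDistribution.isProb_prior TaskDistribution.isProb_init
  TaskDistribution.isMarkov

namespace TaskDistribution

variable {Θ : Type w} {S : Type u} {A : Type v}
  [MeasurableSpace Θ] [MeasurableSpace S] [MeasurableSpace A]

/-- The MDP of task `θ`. -/
def task (𝒯 : TaskDistribution Θ S A) (θ : Θ) : MDP S A where
  trans := 𝒯.trans
  isMarkov := 𝒯.isMarkov
  reward := 𝒯.reward θ
  measurable_reward := 𝒯.measurable_reward.comp (measurable_const.prodMk measurable_id)
  γ := 𝒯.γ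
  γ_pos := 𝒯.γ_pos
  γ_lt_one := 𝒯.γ_lt_one

/-- Initial distribution on partial trajectories. -/
def augInit (𝒯 : TaskDistribution Θ S A) : Measure (PartialTraj S A) :=
  𝒯.init.map PartialTraj.start

instance (𝒯 : TaskDistribution Θ S A) : IsProbabilityMeasure 𝒯.augInit :=
  Measure.isProbabilityMeasure_map PartialTraj.measurable_start.aemeasurable

/-- `J_M(π)` for a reward-informed history policy `π`. -/
def J (𝒯 : TaskDistribution Θ S A) (π : Kernel (PartialTraj S A) A) [IsMarkovKernel π]
    (θ : Θ) : ℝ :=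
  (𝒯.task θ).augment.J 𝒯.augInit π

/-- `max_π J_M(π)`. -/
def Jstar (𝒯 : TaskDistribution Θ S A) (θ : Θ) : ℝ :=
  (𝒯.task θ).augment.Jstar 𝒯.augInit

/-- `Q*_M(l, a)`. -/
def Qstar (𝒯 : TaskDistribution Θ S A) (θ : Θ) (l : PartialTraj S A) (a : A) : ℝ :=
  (𝒯.task θ).augment.Qstar l a

/-- One step of the state-action chains of all tasks, as a kernel in the task as well. -/
def jointStep (𝒯 : TaskDistribution Θ S A) (π : Kernel (PartialTraj S A) A) :
    Kernel (Θ × PartialTraj S A × A) (PartialTraj S A × A) :=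
  (Kernel.id ×ₖ π) ∘ₖ (Kernel.id ×ₖ 𝒯.trans.comap
      (fun x : Θ × PartialTraj S A × A => (x.2.1.last, x.2.2))
      (by have := PartialTraj.measurable_last (S := S) (A := A); fun_prop)).map
    (fun y : (Θ × PartialTraj S A × A) × S =>
      y.1.2.1.extend y.1.2.2 (𝒯.reward y.1.1 y.1.2.1.last y.1.2.2) y.2)

lemma jointStep_apply (𝒯 : TaskDistribution Θ S A) (π : Kernel (PartialTraj S A) A)
    (x : Θ × PartialTraj S A × A) :
    𝒯.jointStep π x = (𝒯.task x.1).augment.step π x.2 := by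
  have h1 := PartialTraj.measurable_last (S := S) (A := A)
  have h2 := PartialTraj.measurable_extend (S := S) (A := A)
  have h4 : Measurable fun y : (Θ × PartialTraj S A × A) × S =>
      𝒯.reward y.1.1 y.1.2.1.last y.1.2.2 :=
    𝒯.measurable_reward.comp ((by fun_prop : Measurable
      fun y : (Θ × PartialTraj S A × A) × S => (y.1.1, y.1.2.1.last, y.1.2.2)))
  have h5 : Measurable fun y : (PartialTraj S A × A) × S =>
      𝒯.reward x.1 y.1.1.last y.1.2 :=
    𝒯.measurable_reward.comp ((by fun_prop : Measurable
      fun y : (PartialTraj S A × A) × S => (x.1, y.1.1.last, y.1.2)))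
  have h6 : Measurable (fun y : (Θ × PartialTraj S A × A) × S =>
      y.1.2.1.extend y.1.2.2 (𝒯.reward y.1.1 y.1.2.1.last y.1.2.2) y.2) :=
    h2.comp (f := fun y : (Θ × PartialTraj S A × A) × S =>
      (y.1.2.1, y.1.2.2, 𝒯.reward y.1.1 y.1.2.1.last y.1.2.2, y.2)) (by fun_prop)
  have h7 : Measurable (fun y : (PartialTraj S A × A) × S =>
      y.1.1.extend y.1.2 (𝒯.reward x.1 y.1.1.last y.1.2) y.2) :=
    h2.comp (f := fun y : (PartialTraj S A × A) × S =>
      (y.1.1, y.1.2, 𝒯.reward x.1 y.1.1.last y.1.2, y.2)) (by fun_prop)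
  rw [jointStep, MDP.step, Kernel.comp_apply, Kernel.comp_apply]
  congr 1
  rw [Kernel.map_apply _ h6]
  change _ = (Kernel.map _ (fun y : (PartialTraj S A × A) × S =>
      y.1.1.extend y.1.2 (𝒯.reward x.1 y.1.1.last y.1.2) y.2)) x.2
  rw [Kernel.map_apply _ h7, Kernel.prod_apply, Kernel.prod_apply, Kernel.id_apply,
    Kernel.id_apply, Measure.dirac_prod, Measure.dirac_prod,
    Measure.map_map h6 (by fun_prop), Measure.map_map h7 (by fun_prop)]
  rfl

lemma measurable_occupancy (𝒯 : TaskDistribution Θ S A) (π : Kernel (PartialTraj S A) A)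
    [IsMarkovKernel π] : Measurable fun θ => (𝒯.task θ).augment.occupancy 𝒯.augInit π := by
  have hpath : ∀ t, Measurable fun θ => ((𝒯.task θ).augment.pathLaw π (𝒯.augInit ⊗ₘ π)).map
      (fun ω => ω t) := by
    intro t
    induction t with
    | zero => simp only [MDP.pathLaw_map_zero, measurable_const]
    | succ t ih =>
      let κ : Kernel Θ (PartialTraj S A × A) := ⟨_, ih⟩
      have : IsMarkovKernel κ := ⟨fun θ => by
        change IsProbabilityMeasure (Measure.map _ _)
        exact Measure.isProbabilityMeasure_map (measurable_pi_apply t).aemeasurable⟩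
      convert (𝒯.jointStep π ∘ₖ (Kernel.id ×ₖ κ)).measurable using 2 with θ
      rw [MDP.pathLaw_map_succ, Kernel.comp_apply, Kernel.prod_apply, Kernel.id_apply,
        Measure.dirac_prod]
      ext B hB
      rw [Measure.bind_apply hB (Kernel.aemeasurable _),
        Measure.bind_apply hB (Kernel.aemeasurable _),
        lintegral_map (μ := κ θ) (Kernel.measurable_coe _ hB) (by fun_prop)]
      simp only [jointStep_apply]
      rfl
  have hstate : ∀ t, Measurable fun θ => (𝒯.task θ).augment.stateLaw 𝒯.augInit π t := by
    intro t
    have := (Measure.measurable_map (Prod.fst : PartialTraj S A × A → _) measurable_fst).comp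
      (hpath t)
    convert this using 2 with θ
    rw [Function.comp_apply, Measure.map_map measurable_fst (measurable_pi_apply t)]
    rfl
  refine Measure.measurable_of_measurable_coe _ fun B hB => ?_
  simp only [MDP.occupancy, Measure.sum_apply _ hB, Measure.smul_apply, smul_eq_mul]
  exact Measurable.tsum fun t =>
    (measurable_const : Measurable fun _ : Θ => ENNReal.ofReal ((1 - 𝒯.γ) * 𝒯.γ ^ t)).mul
      ((Measure.measurable_coe hB).comp (hstate t))

/-- The discounted occupancy of `π` over partial trajectories, given the task. -/
def occupancy (𝒯 : TaskDistribution Θ S A) (π : Kernel (PartialTraj S A) A)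
    [IsMarkovKernel π] : Kernel Θ (PartialTraj S A) where
  toFun θ := (𝒯.task θ).augment.occupancy 𝒯.augInit π
  measurable' := 𝒯.measurable_occupancy π

instance (𝒯 : TaskDistribution Θ S A) (π : Kernel (PartialTraj S A) A) [IsMarkovKernel π] :
    IsMarkovKernel (𝒯.occupancy π) :=
  ⟨fun θ => inferInstanceAs
    (IsProbabilityMeasure ((𝒯.task θ).augment.occupancy 𝒯.augInit π))⟩

/-- The distribution `p(l) = ∫ p(M) d_{M,π}(l) dM` on partial trajectories. -/
def trajDist (𝒯 : TaskDistribution Θ S A) (π : Kernel (PartialTraj S A) A)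
    [IsMarkovKernel π] : Measure (PartialTraj S A) :=
  𝒯.occupancy π ∘ₘ 𝒯.prior

/-- The task posterior `p(M | l)`, the conditional law of the task `M` given `l` under the joint law
`p(M) d_{M,π}(l)`. -/
def taskPosterior [StandardBorelSpace Θ] [Nonempty Θ] (𝒯 : TaskDistribution Θ S A)
    (π : Kernel (PartialTraj S A) A) [IsMarkovKernel π] : Kernel (PartialTraj S A) Θ :=
  posterior (𝒯.occupancy π) 𝒯.prior

end TaskDistribution

end

/-
The performance difference lemma, applied to an optimal policy `π*` of a single task, writes the gap
between the optimal return and the return of `π` as the average of `V^π* - ∫ Q^π* dπ` over the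
discounted occupancy of `π`. Optimality gives `Q^π* = Q*` and, since switching to a fixed action
wherever it beats `π*` for one step cannot improve on `π*`, also `V^π* = max_a Q*`. Averaging over
the prior, Bayes' rule turns the iterated mean over tasks and occupancies into one over `p` and the
task posterior, which is the formula; the bound holds because an average over actions is at most
the supremum. That this supremum over uncountably many actions is almost everywhere measurable
follows from measurable projection: analytic sets are universally measurable.
-/

section MeasurableProjection

lemma isCompact_setOf_forall_le (n : ℕ → ℕ) : IsCompact {x : ℕ → ℕ | ∀ i, x i ≤ n i} := by
  have hbox : {x : ℕ → ℕ | ∀ i, x i ≤ n i} = Set.univ.pi fun i => Set.Iic (n i) := by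
    ext; simp [Pi.le_def]
  rw [hbox]
  exact isCompact_univ_pi fun i => (Set.finite_Iic (n i)).isCompact

lemma exists_cylinder_subset_of_isOpen {n : ℕ → ℕ} {U : Set (ℕ → ℕ)} (hU : IsOpen U)
    (h : {x | ∀ i, x i ≤ n i} ⊆ U) : ∃ k, {x : ℕ → ℕ | ∀ i < k, x i ≤ n i} ⊆ U := by
  by_contra! hcon
  have hescape : ∀ k, ∃ x : ℕ → ℕ, (∀ i < k, x i ≤ n i) ∧ x ∉ U := fun k => by
    simpa [Set.not_subset] using hcon k
  choose x hx hxU using hescape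
  obtain ⟨y, hy, φ, hφ, hlim⟩ := (isCompact_setOf_forall_le n).tendsto_subseq
    (x := fun k i => min (x k i) (n i)) (fun k i => min_le_right _ _)
  have hlim' : Filter.Tendsto (fun k => x (φ k)) Filter.atTop (nhds y) := by
    rw [tendsto_pi_nhds] at hlim ⊢
    intro i
    refine (hlim i).congr' ?_
    filter_upwards [Filter.eventually_gt_atTop i] with k hk
    exact min_eq_left (hx _ i (hk.trans_le (hφ.id_le k)))
  exact hU.isClosed_compl.mem_of_tendsto hlim' (Filter.Eventually.of_forall fun k => hxU _) (h hy)

lemma exists_measure_image_le_add {ι α : Type*} [MeasurableSpace α] (μ : Measure α)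
    [IsFiniteMeasure μ] (f : ι → α) (g : ι → ℕ) (E : Set ι) {ε : ℝ≥0∞} (hε : ε ≠ 0) :
    ∃ m : ℕ, μ (f '' E) ≤ μ (f '' (E ∩ {x | g x ≤ m})) + ε := by
  have hE : f '' E = ⋃ m : ℕ, f '' (E ∩ {x | g x ≤ m}) := by
    rw [← Set.image_iUnion, ← Set.inter_iUnion,
      Set.eq_univ_of_forall fun x => Set.mem_iUnion.2 ⟨g x, le_refl (g x)⟩, Set.inter_univ]
  have hmono : Monotone fun m : ℕ => f '' (E ∩ {x | g x ≤ m}) := fun a b hab =>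
    Set.image_mono (Set.inter_subset_inter_right _ fun x (hx : g x ≤ a) => hx.trans hab)
  have hlim := tendsto_measure_iUnion_atTop (μ := μ) hmono
  rw [← hE] at hlim
  obtain h0 | h0 := eq_or_ne (μ (f '' E)) 0
  · exact ⟨0, by simp [h0]⟩
  · obtain ⟨m, hm⟩ := (hlim.eventually
      (lt_mem_nhds (ENNReal.sub_lt_self (measure_ne_top _ _) h0 hε))).exists
    exact ⟨m, tsub_le_iff_right.1 hm.le⟩

lemma exists_measure_range_le_cylinder {α : Type*} [MeasurableSpace α] (μ : Measure α)
    [IsFiniteMeasure μ] (f : (ℕ → ℕ) → α) {ε : ℝ≥0∞} (hε : ε ≠ 0) :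
    ∃ n : ℕ → ℕ, ∀ k, μ (Set.range f) ≤ μ (f '' {x | ∀ i < k, x i ≤ n i}) + ε := by
  obtain ⟨δ, hδ, hδε⟩ := ENNReal.exists_pos_sum_of_countable' hε ℕ
  choose m hm using fun (E : Set (ℕ → ℕ)) (k : ℕ) =>
    exists_measure_image_le_add μ f (fun x => x k) E (hδ k).ne'
  let E : ℕ → Set (ℕ → ℕ) := fun k =>
    Nat.rec Set.univ (fun k E => E ∩ {x | x k ≤ m E k}) k
  have hE_succ : ∀ k, E (k + 1) = E k ∩ {x | x k ≤ m (E k) k} := fun _ => rfl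
  have hE_measure : ∀ k, μ (Set.range f) ≤ μ (f '' E k) + ∑ i ∈ Finset.range k, δ i := by
    intro k
    induction k with
    | zero => simp [E]
    | succ k ih =>
      rw [Finset.sum_range_succ, hE_succ, add_comm (∑ i ∈ Finset.range k, δ i), ← add_assoc]
      exact ih.trans (by gcongr; exact hm _ _)
  have hE_cylinder : ∀ k, E k = {x : ℕ → ℕ | ∀ i < k, x i ≤ m (E i) i} := by
    intro k
    induction k with
    | zero => simp [E]
    | succ k ih =>
      ext x
      rw [hE_succ, Set.mem_inter_iff, Set.ext_iff.1 ih x]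
      exact Nat.forall_lt_succ_right.symm
  refine ⟨fun i => m (E i) i, fun k => ?_⟩
  rw [← hE_cylinder]
  exact (hE_measure k).trans (by gcongr; exact (ENNReal.sum_le_tsum _).trans hδε.le)

lemma exists_isCompact_measure_le_of_analyticSet {α : Type*} [TopologicalSpace α]
    [MeasurableSpace α] (μ : Measure α) [IsFiniteMeasure μ] [μ.OuterRegular] {s : Set α}
    (hs : AnalyticSet s) {ε : ℝ≥0∞} (hε : ε ≠ 0) : ∃ K ⊆ s, IsCompact K ∧ μ s ≤ μ K + ε := by
  rw [AnalyticSet] at hs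
  obtain rfl | ⟨f, hf, rfl⟩ := hs
  · exact ⟨∅, subset_rfl, isCompact_empty, by simp⟩
  obtain ⟨n, hn⟩ := exists_measure_range_le_cylinder μ f hε
  refine ⟨f '' {x | ∀ i, x i ≤ n i}, Set.image_subset_range _ _,
    (isCompact_setOf_forall_le n).image hf, le_of_forall_gt fun c hc => ?_⟩
  obtain ⟨U, hKU, hU, hUc⟩ := Set.exists_isOpen_lt_of_lt _ _ (lt_tsub_iff_right.2 hc)
  obtain ⟨k, hk⟩ := exists_cylinder_subset_of_isOpen (hU.preimage hf) (Set.image_subset_iff.1 hKU)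
  calc μ (Set.range f) ≤ μ (f '' {x | ∀ i < k, x i ≤ n i}) + ε := hn k
    _ ≤ μ U + ε := by gcongr; exact Set.image_subset_iff.2 hk
    _ < c := lt_tsub_iff_right.1 hUc

lemma nullMeasurableSet_of_analyticSet {α : Type*} [TopologicalSpace α] [T2Space α]
    [MeasurableSpace α] [OpensMeasurableSpace α] (μ : Measure α) [IsFiniteMeasure μ]
    [μ.OuterRegular] {s : Set α} (hs : AnalyticSet s) : NullMeasurableSet s μ := by
  choose K hKs hK hle using fun n : ℕ =>
    exists_isCompact_measure_le_of_analyticSet μ hs (ε := (n : ℝ≥0∞)⁻¹) (by simp)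
  have hmeas : MeasurableSet (⋃ n, K n) :=
    MeasurableSet.iUnion fun n => (hK n).isClosed.measurableSet
  have hge : μ s ≤ μ (⋃ n, K n) := by
    have hlim := (tendsto_const_nhds (x := μ (⋃ n, K n))).add ENNReal.tendsto_inv_nat_nhds_zero
    rw [add_zero] at hlim
    exact ge_of_tendsto' hlim fun n =>
      (hle n).trans (by gcongr; exact Set.subset_iUnion K n)
  exact hmeas.nullMeasurableSet.congr (ae_eq_of_subset_of_measure_ge (Set.iUnion_subset hKs) hge
    hmeas.nullMeasurableSet (measure_ne_top _ _))

-- A measurable set in a product depends on countably many measurable rectangles only.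
lemma exists_standardBorel_preimage {X Y : Type*} [MeasurableSpace X] [MeasurableSpace Y]
    {E : Set (X × Y)} (hE : MeasurableSet E) :
    ∃ (W : Type) (_ : MeasurableSpace W) (_ : StandardBorelSpace W) (φ : X → W)
      (E' : Set (W × Y)), Measurable φ ∧ MeasurableSet E' ∧ E = Prod.map φ id ⁻¹' E' := by
  induction E, hE using MeasurableSpace.induction_on_inter
    (generateFrom_prod (α := X) (β := Y)).symm (isPiSystem_prod (α := X) (β := Y)) with
  | empty => exact ⟨Unit, _, inferInstance, fun _ => (), ∅, measurable_const, .empty, rfl⟩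
  | basic E hE =>
    obtain ⟨s, hs, t, ht, rfl⟩ := hE
    refine ⟨Prop, _, inferInstance, fun x => x ∈ s, {True} ×ˢ t, hs.mem,
      (measurableSet_singleton _).prod ht, ?_⟩
    ext; simp
  | compl E _ ih =>
    obtain ⟨W, mW, hW, φ, E', hφ, hE', rfl⟩ := ih
    exact ⟨W, mW, hW, φ, E'ᶜ, hφ, hE'.compl, rfl⟩
  | iUnion E _ _ ih =>
    choose W mW hW φ E' hφ hE' hE using ih
    refine ⟨∀ n, W n, inferInstance, inferInstance, fun x n => φ n x,
      ⋃ n, Prod.map (fun w => w n) id ⁻¹' E' n, measurable_pi_lambda _ hφ,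
      .iUnion fun n => (hE' n).preimage (by fun_prop), ?_⟩
    simp only [hE, Set.preimage_iUnion]
    rfl

lemma nullMeasurableSet_image_fst {X Y : Type*} [MeasurableSpace X] [MeasurableSpace Y]
    [StandardBorelSpace Y] (μ : Measure X) [IsFiniteMeasure μ] {E : Set (X × Y)}
    (hE : MeasurableSet E) : NullMeasurableSet (Prod.fst '' E) μ := by
  obtain ⟨W, _, _, φ, E', hφ, hE', rfl⟩ := exists_standardBorel_preimage hE
  let := upgradeStandardBorel W
  have himage : Prod.fst '' (Prod.map φ id ⁻¹' E') = φ ⁻¹' (Prod.fst '' E') := by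
    ext x
    simp
  rw [himage]
  exact (nullMeasurableSet_of_analyticSet (μ.map φ)
    (hE'.analyticSet_image measurable_fst)).preimage (hφ.quasiMeasurePreserving μ)

theorem aemeasurable_iSup_of_standardBorel {X Y : Type*} [MeasurableSpace X] [MeasurableSpace Y]
    [StandardBorelSpace Y] [Nonempty Y] {μ : Measure X} [IsFiniteMeasure μ] {g : X × Y → ℝ}
    (hg : Measurable g) (hbdd : ∀ᵐ x ∂μ, BddAbove (Set.range fun y => g (x, y))) :
    AEMeasurable (fun x => ⨆ y, g (x, y)) μ := by
  have hmeas : Measurable fun x : NullMeasurableSpace X μ => ⨆ y, g (x, y) := by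
    refine measurable_of_Ioi fun c =>
      (nullMeasurableSet_image_fst μ (hg (measurableSet_Ioi (a := c)))).congr ?_
    refine Filter.eventuallyEq_set.2 ?_
    filter_upwards [hbdd] with x hx
    have hx_iff : x ∈ Prod.fst '' (g ⁻¹' Set.Ioi c) ↔ c < ⨆ y, g (x, y) := by
      simp [lt_ciSup_iff hx]
    exact hx_iff
  exact NullMeasurable.aemeasurable fun s hs => hmeas hs

end MeasurableProjection

section Integration

variable {X Y : Type*} [MeasurableSpace X] [MeasurableSpace Y] {μ : Measure X}

lemma integrable_of_abs_le_of_integrable {f g : X → ℝ} (hg : Integrable g μ) (hf : Measurable f)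
    (hfg : ∀ x, |f x| ≤ g x) : Integrable f μ :=
  hg.mono' hf.aestronglyMeasurable (Filter.Eventually.of_forall hfg)

lemma integrable_of_abs_le [IsFiniteMeasure μ] {f : X → ℝ} (hf : Measurable f) {C : ℝ}
    (hC : ∀ x, |f x| ≤ C) : Integrable f μ :=
  integrable_of_abs_le_of_integrable (integrable_const C) hf hC

lemma abs_integral_le_of_abs_le [IsProbabilityMeasure μ] {f : X → ℝ} {C : ℝ}
    (hC : ∀ x, |f x| ≤ C) : |∫ x, f x ∂μ| ≤ C := by
  simpa using norm_integral_le_of_norm_le_const (μ := μ) (f := f) (Filter.Eventually.of_forall hC)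

lemma integral_measure_comp {κ : Kernel X Y} {f : Y → ℝ} (hf : Integrable f (κ ∘ₘ μ)) :
    ∫ y, f y ∂(κ ∘ₘ μ) = ∫ x, ∫ y, f y ∂κ x ∂μ := by
  rw [Measure.comp_eq_comp_const_apply] at hf ⊢
  rw [Kernel.integral_comp hf, Kernel.const_apply]

lemma integrable_integral_of_compProd [SFinite μ] {κ : Kernel X Y} [IsSFiniteKernel κ]
    {f : X × Y → ℝ} (hf : Integrable f (μ ⊗ₘ κ)) : Integrable (fun x => ∫ y, f (x, y) ∂κ x) μ := by
  simpa using! hf.integral_compProd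

end Integration

section DiscountedSums

variable {γ C : ℝ}

lemma abs_pow_mul_le (hγ₀ : 0 ≤ γ) {f : ℕ → ℝ} (hf : ∀ t, |f t| ≤ C) (t : ℕ) :
    |γ ^ t * f t| ≤ γ ^ t * C := by
  rw [abs_mul, abs_of_nonneg (pow_nonneg hγ₀ t)]
  exact mul_le_mul_of_nonneg_left (hf t) (pow_nonneg hγ₀ t)

lemma summable_pow_mul_of_abs_le (hγ₀ : 0 ≤ γ) (hγ₁ : γ < 1) {f : ℕ → ℝ} (hf : ∀ t, |f t| ≤ C) :
    Summable fun t => γ ^ t * f t :=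
  Summable.of_norm_bounded ((summable_geometric_of_lt_one hγ₀ hγ₁).mul_right C)
    (abs_pow_mul_le hγ₀ hf)

lemma abs_le_of_hasSum_pow_mul (hγ₀ : 0 ≤ γ) (hγ₁ : γ < 1) {f : ℕ → ℝ} (hf : ∀ t, |f t| ≤ C)
    {s : ℝ} (hs : HasSum (fun t => γ ^ t * f t) s) : |s| ≤ C / (1 - γ) := by
  rw [div_eq_inv_mul]
  exact hs.norm_le_of_bounded ((hasSum_geometric_of_lt_one hγ₀ hγ₁).mul_right C)
    (abs_pow_mul_le hγ₀ hf)

lemma hasSum_integral_pow_mul (hγ₀ : 0 ≤ γ) (hγ₁ : γ < 1) {Y : Type*} [MeasurableSpace Y]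
    {μ : Measure Y} [IsProbabilityMeasure μ] {f : ℕ → Y → ℝ} (hf : ∀ t, Measurable (f t))
    (hC : ∀ t y, |f t y| ≤ C) :
    HasSum (fun t => γ ^ t * ∫ y, f t y ∂μ) (∫ y, ∑' t, γ ^ t * f t y ∂μ) := by
  have hnorm : Summable fun t => ∫ y, ‖γ ^ t * f t y‖ ∂μ := by
    simp only [norm_mul, integral_const_mul, norm_pow, Real.norm_of_nonneg hγ₀]
    exact summable_pow_mul_of_abs_le hγ₀ hγ₁ fun t =>
      abs_integral_le_of_abs_le fun y => (abs_norm _).trans_le (hC t y)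
  simpa only [integral_const_mul] using hasSum_integral_of_summable_integral_norm
    (fun t => (integrable_of_abs_le (hf t) (hC t)).const_mul _) hnorm

end DiscountedSums

namespace MDP

section Values

variable {X A : Type*} [MeasurableSpace X] [MeasurableSpace A] (M : MDP X A)
  (π : Kernel X A) {C : ℝ}

lemma abs_uncurry_reward_le (hC : ∀ x a, |M.reward x a| ≤ C) (z : X × A) :
    |Function.uncurry M.reward z| ≤ C :=
  hC z.1 z.2

/-- The one-step expectation operator of the state-action chain under `π`; its `t`-th iterate
applied to the reward is the expected reward after `t` steps. -/
noncomputable def transOp (f : X × A → ℝ) (z : X × A) : ℝ :=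
  ∫ y, f y ∂M.step π z

lemma measurable_iterate_transOp {f : X × A → ℝ} (hf : Measurable f) (t : ℕ) :
    Measurable ((M.transOp π)^[t] f) := by
  induction t with
  | zero => exact hf
  | succ t ih =>
    rw [Function.iterate_succ_apply']
    exact ih.stronglyMeasurable.integral_kernel.measurable

variable [IsMarkovKernel π]

lemma step_apply (z : X × A) : M.step π z = M.trans z ⊗ₘ π := by
  rw [step, Kernel.comp_apply, Measure.compProd_eq_comp_prod]

lemma abs_iterate_transOp_le {f : X × A → ℝ} (hfC : ∀ z, |f z| ≤ C) (t : ℕ) (z : X × A) :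
    |(M.transOp π)^[t] f z| ≤ C := by
  induction t generalizing z with
  | zero => exact hfC z
  | succ t ih =>
    rw [Function.iterate_succ_apply']
    exact abs_integral_le_of_abs_le ih

lemma integral_pathLaw_eval (μ : Measure (X × A)) [IsProbabilityMeasure μ] {f : X × A → ℝ}
    (hf : Measurable f) (hfC : ∀ z, |f z| ≤ C) (t : ℕ) :
    ∫ ω, f (ω t) ∂M.pathLaw π μ = ∫ z, (M.transOp π)^[t] f z ∂μ := by
  have hmap : ∀ (t : ℕ) {g : X × A → ℝ}, Measurable g →
      ∫ ω, g (ω t) ∂M.pathLaw π μ = ∫ z, g z ∂(M.pathLaw π μ).map fun ω => ω t :=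
    fun t g hg => (integral_map (measurable_pi_apply t).aemeasurable hg.aestronglyMeasurable).symm
  induction t generalizing f with
  | zero => rw [hmap 0 hf, pathLaw_map_zero, Function.iterate_zero_apply]
  | succ t ih =>
    have hstep : Measurable (M.transOp π f) := M.measurable_iterate_transOp π hf 1
    rw [hmap _ hf, pathLaw_map_succ, integral_measure_comp, Function.iterate_succ_apply,
      ← ih hstep (M.abs_iterate_transOp_le π hfC 1), hmap t hstep]
    · rfl
    · have := Measure.isProbabilityMeasure_map (μ := M.pathLaw π μ)
        (measurable_pi_apply t).aemeasurable
      exact integrable_of_abs_le hf hfC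

variable (hC : ∀ x a, |M.reward x a| ≤ C)

include hC

lemma hasSum_integral_discountedReturn (μ : Measure (X × A)) [IsProbabilityMeasure μ] :
    HasSum (fun t => M.γ ^ t * ∫ ω, M.reward (ω t).1 (ω t).2 ∂M.pathLaw π μ)
      (∫ ω, M.discountedReturn ω ∂M.pathLaw π μ) :=
  hasSum_integral_pow_mul M.γ_pos.le M.γ_lt_one
    (fun t => M.measurable_reward.comp (measurable_pi_apply t)) fun _ _ => hC _ _

lemma hasSum_Q (x : X) (a : A) :
    HasSum (fun t => M.γ ^ t * (M.transOp π)^[t] (Function.uncurry M.reward) (x, a))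
      (M.Q π x a) := by
  refine (M.hasSum_integral_discountedReturn π hC (Measure.dirac (x, a))).congr_fun fun t => ?_
  rw [← integral_dirac' _ (x, a)
      (M.measurable_iterate_transOp π M.measurable_reward t).stronglyMeasurable,
    ← M.integral_pathLaw_eval π _ M.measurable_reward (M.abs_uncurry_reward_le hC)]
  rfl

lemma abs_Q_le (x : X) (a : A) : |M.Q π x a| ≤ C / (1 - M.γ) :=
  abs_le_of_hasSum_pow_mul M.γ_pos.le M.γ_lt_one
    (fun t => M.abs_iterate_transOp_le π (M.abs_uncurry_reward_le hC) t (x, a))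
    (M.hasSum_Q π hC x a)

lemma measurable_Q : Measurable fun z : X × A => M.Q π z.1 z.2 := by
  refine measurable_of_tendsto_metrizable (fun n => ?_)
    (tendsto_pi_nhds.2 fun z => (M.hasSum_Q π hC z.1 z.2).tendsto_sum_nat)
  exact Finset.measurable_fun_sum _ fun t _ =>
    (M.measurable_iterate_transOp π M.measurable_reward t).const_mul _

lemma measurable_Q_left (a : A) : Measurable fun x => M.Q π x a :=
  Measurable.of_uncurry_right (f := M.Q π) (M.measurable_Q π hC)

lemma measurable_Q_right (x : X) : Measurable (M.Q π x) :=
  Measurable.of_uncurry_left (f := M.Q π) (M.measurable_Q π hC)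

lemma integrable_Q (μ : Measure (X × A)) [IsFiniteMeasure μ] :
    Integrable (fun z : X × A => M.Q π z.1 z.2) μ :=
  integrable_of_abs_le (M.measurable_Q π hC) fun z => M.abs_Q_le π hC z.1 z.2

lemma hasSum_integral_Q (μ : Measure (X × A)) [IsProbabilityMeasure μ] :
    HasSum (fun t => M.γ ^ t * ∫ z, (M.transOp π)^[t] (Function.uncurry M.reward) z ∂μ)
      (∫ z, M.Q π z.1 z.2 ∂μ) := by
  have h := hasSum_integral_pow_mul M.γ_pos.le M.γ_lt_one (μ := μ)
    (M.measurable_iterate_transOp π M.measurable_reward)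
    (M.abs_iterate_transOp_le π (M.abs_uncurry_reward_le hC))
  simpa only [fun z : X × A => (M.hasSum_Q π hC z.1 z.2).tsum_eq] using h

lemma integral_discountedReturn_eq_integral_Q (μ : Measure (X × A)) [IsProbabilityMeasure μ] :
    ∫ ω, M.discountedReturn ω ∂M.pathLaw π μ = ∫ z, M.Q π z.1 z.2 ∂μ := by
  refine (M.hasSum_integral_discountedReturn π hC μ).unique
    ((M.hasSum_integral_Q π hC μ).congr_fun fun t => ?_)
  rw [← M.integral_pathLaw_eval π μ M.measurable_reward (M.abs_uncurry_reward_le hC)]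
  rfl

lemma J_eq_integral_integral_Q (ρ : Measure X) [IsProbabilityMeasure ρ] :
    M.J ρ π = ∫ x, ∫ a, M.Q π x a ∂π x ∂ρ := by
  rw [J, M.integral_discountedReturn_eq_integral_Q π hC,
    Measure.integral_compProd (M.integrable_Q π hC _)]

lemma V_eq_integral_Q (x : X) : M.V π x = ∫ a, M.Q π x a ∂π x := by
  rw [V, M.J_eq_integral_integral_Q π hC, integral_dirac' _ _
    (M.measurable_Q π hC).stronglyMeasurable.integral_kernel_prod_right']

lemma J_eq_integral_V (ρ : Measure X) [IsProbabilityMeasure ρ] : M.J ρ π = ∫ x, M.V π x ∂ρ := by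
  simp only [M.J_eq_integral_integral_Q π hC, M.V_eq_integral_Q π hC]

lemma measurable_V : Measurable (M.V π) := by
  rw [funext (M.V_eq_integral_Q π hC)]
  exact (M.measurable_Q π hC).stronglyMeasurable.integral_kernel_prod_right'.measurable

lemma abs_V_le (x : X) : |M.V π x| ≤ C / (1 - M.γ) := by
  rw [M.V_eq_integral_Q π hC]
  exact abs_integral_le_of_abs_le (M.abs_Q_le π hC x)

lemma integrable_V (ρ : Measure X) [IsFiniteMeasure ρ] : Integrable (M.V π) ρ :=
  integrable_of_abs_le (M.measurable_V π hC) (M.abs_V_le π hC)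

theorem Q_eq_reward_add_integral_V (x : X) (a : A) :
    M.Q π x a = M.reward x a + M.γ * ∫ x', M.V π x' ∂M.trans (x, a) := by
  have htail := (hasSum_nat_add_iff' 1).2 (M.hasSum_Q π hC x a)
  have hshift := (M.hasSum_integral_Q π hC (M.step π (x, a))).mul_left M.γ
  have heq : M.γ * ∫ z, M.Q π z.1 z.2 ∂M.step π (x, a) = M.Q π x a - M.reward x a := by
    simp only [pow_succ', mul_assoc, Function.iterate_succ_apply', Finset.sum_range_one,
      pow_zero, one_mul, Function.iterate_zero_apply] at htail
    exact hshift.unique htail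
  rw [step_apply, Measure.integral_compProd (M.integrable_Q π hC _)] at heq
  simp only [M.V_eq_integral_Q π hC]
  linarith

end Values

end MDP

namespace MDP

section Occupancy

variable {X A : Type*} [MeasurableSpace X] [MeasurableSpace A] (M : MDP X A)
  (ρ : Measure X) (π : Kernel X A) [IsMarkovKernel π] {C : ℝ}

lemma one_sub_γ_pos : 0 < 1 - M.γ :=
  sub_pos.2 M.γ_lt_one

lemma stateLaw_eq_fst (t : ℕ) :
    M.stateLaw ρ π t = ((M.pathLaw π (ρ ⊗ₘ π)).map fun ω => ω t).fst := by
  rw [Measure.fst, Measure.map_map measurable_fst (measurable_pi_apply t)]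
  rfl

variable [IsProbabilityMeasure ρ]

lemma stateLaw_zero : M.stateLaw ρ π 0 = ρ := by
  rw [stateLaw_eq_fst, pathLaw_map_zero, Measure.fst_compProd]

lemma pathLaw_map_succ_eq_compProd (μ : Measure (X × A)) [IsProbabilityMeasure μ] (t : ℕ) :
    (M.pathLaw π μ).map (fun ω => ω (t + 1)) =
      (M.trans ∘ₘ (M.pathLaw π μ).map fun ω => ω t) ⊗ₘ π := by
  rw [pathLaw_map_succ, step, ← Measure.comp_assoc, Measure.compProd_eq_comp_prod]

lemma pathLaw_map_eval_eq_stateLaw_compProd (t : ℕ) :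
    (M.pathLaw π (ρ ⊗ₘ π)).map (fun ω => ω t) = M.stateLaw ρ π t ⊗ₘ π := by
  rw [stateLaw_eq_fst]
  cases t with
  | zero => rw [pathLaw_map_zero, Measure.fst_compProd]
  | succ t => rw [pathLaw_map_succ_eq_compProd, Measure.fst_compProd]

lemma stateLaw_succ (t : ℕ) :
    M.stateLaw ρ π (t + 1) = M.trans ∘ₘ (M.stateLaw ρ π t ⊗ₘ π) := by
  rw [stateLaw_eq_fst, pathLaw_map_succ_eq_compProd, Measure.fst_compProd,
    pathLaw_map_eval_eq_stateLaw_compProd]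

lemma hasSum_integral_occupancy {f : X → ℝ} (hf : Measurable f) (hfC : ∀ x, |f x| ≤ C) :
    HasSum (fun t => (1 - M.γ) * (M.γ ^ t * ∫ x, f x ∂M.stateLaw ρ π t))
      (∫ x, f x ∂M.occupancy ρ π) := by
  have h := hasSum_integral_measure (integrable_of_abs_le (μ := M.occupancy ρ π) hf hfC)
  refine h.congr_fun fun t => ?_
  rw [integral_smul_measure, ENNReal.toReal_ofReal
    (mul_nonneg M.one_sub_γ_pos.le (pow_nonneg M.γ_pos.le t)), smul_eq_mul, mul_assoc]

theorem J_eq_integral_occupancy (hC : ∀ x a, |M.reward x a| ≤ C) :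
    M.J ρ π = 1 / (1 - M.γ) * ∫ x, ∫ a, M.reward x a ∂π x ∂M.occupancy ρ π := by
  have hreward : ∀ t, ∫ ω, M.reward (ω t).1 (ω t).2 ∂M.pathLaw π (ρ ⊗ₘ π) =
      ∫ x, ∫ a, M.reward x a ∂π x ∂M.stateLaw ρ π t := fun t => by
    have hr : Integrable (Function.uncurry M.reward) (M.stateLaw ρ π t ⊗ₘ π) :=
      integrable_of_abs_le M.measurable_reward (M.abs_uncurry_reward_le hC)
    refine Eq.trans ?_ (Measure.integral_compProd hr)
    rw [← pathLaw_map_eval_eq_stateLaw_compProd, integral_map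
      (measurable_pi_apply t).aemeasurable M.measurable_reward.aestronglyMeasurable]
    rfl
  have hJ := (M.hasSum_integral_discountedReturn π hC (ρ ⊗ₘ π)).mul_left (1 - M.γ)
  have hocc := M.hasSum_integral_occupancy ρ π
    (M.measurable_reward.stronglyMeasurable.integral_kernel_prod_right (κ := π)).measurable
    fun x => abs_integral_le_of_abs_le (hC x)
  simp only [hreward] at hJ
  rw [hocc.unique hJ, J, ← mul_assoc, one_div_mul_cancel M.one_sub_γ_pos.ne', one_mul]

theorem integral_occupancy_eq {f : X → ℝ} (hf : Measurable f) (hfC : ∀ x, |f x| ≤ C) :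
    ∫ x, f x ∂M.occupancy ρ π = (1 - M.γ) * ∫ x, f x ∂ρ +
      M.γ * ∫ x, ∫ a, ∫ x', f x' ∂M.trans (x, a) ∂π x ∂M.occupancy ρ π := by
  have hnext_meas : Measurable fun z : X × A => ∫ x', f x' ∂M.trans z :=
    hf.stronglyMeasurable.integral_kernel.measurable
  have hnext_le : ∀ z, |∫ x', f x' ∂M.trans z| ≤ C := fun z => abs_integral_le_of_abs_le hfC
  have hnext_int_le : ∀ x, |∫ a, ∫ x', f x' ∂M.trans (x, a) ∂π x| ≤ C := fun x =>
    abs_integral_le_of_abs_le fun a => hnext_le (x, a)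
  have hnext : ∀ t, ∫ x, ∫ a, ∫ x', f x' ∂M.trans (x, a) ∂π x ∂M.stateLaw ρ π t =
      ∫ x, f x ∂M.stateLaw ρ π (t + 1) := fun t => by
    rw [← Measure.integral_compProd (f := fun z => ∫ x', f x' ∂M.trans z)
        (integrable_of_abs_le hnext_meas hnext_le),
      stateLaw_succ, integral_measure_comp (integrable_of_abs_le hf hfC)]
  have hshift := (M.hasSum_integral_occupancy ρ π
    hnext_meas.stronglyMeasurable.integral_kernel_prod_right'.measurable
    hnext_int_le).mul_left M.γ
  have htail := (hasSum_nat_add_iff' 1).2 (M.hasSum_integral_occupancy ρ π hf hfC)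
  simp only [hnext] at hshift
  have heq := hshift.unique (htail.congr_fun fun t => by rw [pow_succ]; ring)
  simp only [Finset.sum_range_one, pow_zero, one_mul, stateLaw_zero] at heq
  linarith

lemma one_sub_γ_mul_integral_le_integral_occupancy {f : X → ℝ} (hf : Measurable f)
    (hfC : ∀ x, |f x| ≤ C) (hf₀ : ∀ x, 0 ≤ f x) :
    (1 - M.γ) * ∫ x, f x ∂ρ ≤ ∫ x, f x ∂M.occupancy ρ π := by
  rw [M.integral_occupancy_eq ρ π hf hfC]
  exact le_add_of_nonneg_right (mul_nonneg M.γ_pos.le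
    (integral_nonneg fun x => integral_nonneg fun a => integral_nonneg hf₀))

/- The Bellman equation turns `V σ - ∫ Q σ dπ` into `V σ` minus its discounted one-step transport
minus the reward; the first two are evaluated by the occupancy flow equation. -/
theorem integral_V_sub_J (σ : Kernel X A) [IsMarkovKernel σ] (hC : ∀ x a, |M.reward x a| ≤ C) :
    (∫ x, M.V σ x ∂ρ) - M.J ρ π =
      1 / (1 - M.γ) * ∫ x, (M.V σ x - ∫ a, M.Q σ x a ∂π x) ∂M.occupancy ρ π := by
  have hr : Integrable (fun z : X × A => M.reward z.1 z.2) (M.occupancy ρ π ⊗ₘ π) :=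
    integrable_of_abs_le M.measurable_reward (M.abs_uncurry_reward_le hC)
  have hV : Integrable (fun z => ∫ x', M.V σ x' ∂M.trans z) (M.occupancy ρ π ⊗ₘ π) :=
    integrable_of_abs_le (M.measurable_V σ hC).stronglyMeasurable.integral_kernel.measurable
      fun z => abs_integral_le_of_abs_le (M.abs_V_le σ hC)
  have hQ : ∫ x, ∫ a, M.Q σ x a ∂π x ∂M.occupancy ρ π =
      (∫ x, ∫ a, M.reward x a ∂π x ∂M.occupancy ρ π) +
        M.γ * ∫ x, ∫ a, ∫ x', M.V σ x' ∂M.trans (x, a) ∂π x ∂M.occupancy ρ π := by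
    rw [← Measure.integral_compProd (M.integrable_Q σ hC _)]
    simp only [M.Q_eq_reward_add_integral_V σ hC]
    rw [integral_add hr (hV.const_mul _), integral_const_mul, Measure.integral_compProd hr,
      Measure.integral_compProd hV]
  have hflow := M.integral_occupancy_eq ρ π (M.measurable_V σ hC) (M.abs_V_le σ hC)
  rw [integral_sub (M.integrable_V σ hC _) (integrable_integral_of_compProd
    (M.integrable_Q σ hC _)), hQ, M.J_eq_integral_occupancy ρ π hC]
  have hγ := M.one_sub_γ_pos.ne'
  field_simp
  linarith

end Occupancy

section Optimality

variable {X A : Type*} [MeasurableSpace X] [MeasurableSpace A] {M : MDP X A}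
  {σ : Kernel X A} [IsMarkovKernel σ] {C : ℝ}

-- Deviate to the fixed action `a` exactly where that beats `σ` for one step.
theorem exists_policy_max_V_Q_le_V (hC : ∀ x a, |M.reward x a| ≤ C) (a : A) :
    ∃ (π : Kernel X A) (_ : IsMarkovKernel π), ∀ x, max (M.V σ x) (M.Q σ x a) ≤ M.V π x := by
  classical
  have hV := M.measurable_V σ hC
  have hQ : Measurable fun x => M.Q σ x a := M.measurable_Q_left σ hC a
  let π : Kernel X A := Kernel.piecewise (measurableSet_lt hV hQ)
    (Kernel.const X (Measure.dirac a)) σ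
  let gain : X → ℝ := fun x => max (M.V σ x) (M.Q σ x a) - M.V σ x
  have hgain_meas : Measurable gain := (hV.max hQ).sub hV
  have hgain_le : ∀ x, |gain x| ≤ 2 * (C / (1 - M.γ)) := fun x => by
    have hVx := abs_le.1 (M.abs_V_le σ hC x)
    have hQx := abs_le.1 (M.abs_Q_le σ hC x a)
    rw [abs_of_nonneg (sub_nonneg.2 (le_max_left _ _)), sub_le_iff_le_add]
    exact max_le (by linarith) (by linarith)
  have hgain : ∀ x, M.V σ x - ∫ b, M.Q σ x b ∂π x = -gain x := fun x => by
    by_cases hx : M.V σ x < M.Q σ x a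
    · simp [π, gain, Kernel.piecewise_apply, hx, hx.le,
        integral_dirac' _ _ (M.measurable_Q_right σ hC x).stronglyMeasurable]
    · simp [π, gain, Kernel.piecewise_apply, hx, not_lt.1 hx, ← M.V_eq_integral_Q σ hC]
  refine ⟨π, inferInstance, fun x => ?_⟩
  have hdiff := M.integral_V_sub_J (Measure.dirac x) π σ hC
  have hmass := M.one_sub_γ_mul_integral_le_integral_occupancy (Measure.dirac x) π
    hgain_meas hgain_le fun x => sub_nonneg.2 (le_max_left _ _)
  simp only [hgain, integral_neg] at hdiff
  rw [integral_dirac' _ _ hV.stronglyMeasurable, ← V, mul_neg, one_div_mul_eq_div] at hdiff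
  rw [integral_dirac' _ _ hgain_meas.stronglyMeasurable,
    ← le_div_iff₀' M.one_sub_γ_pos] at hmass
  linarith

namespace IsOptimal

variable (hσ : M.IsOptimal σ) (hC : ∀ x a, |M.reward x a| ≤ C)

include hσ hC

lemma Q_le (π : Kernel X A) [IsMarkovKernel π] (x : X) (a : A) : M.Q π x a ≤ M.Q σ x a := by
  rw [M.Q_eq_reward_add_integral_V π hC, M.Q_eq_reward_add_integral_V σ hC]
  gcongr
  · exact M.γ_pos.le
  · exact M.integrable_V π hC _
  · exact M.integrable_V σ hC _
  · exact hσ ⟨π, inferInstance⟩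

lemma Qstar_eq (x : X) (a : A) : M.Qstar x a = M.Q σ x a := by
  have hle : ∀ π : Policy X A, (haveI := π.2; M.Q π.1 x a) ≤ M.Q σ x a := fun π =>
    haveI := π.2
    hσ.Q_le hC π.1 x a
  have : Nonempty (Policy X A) := ⟨⟨σ, inferInstance⟩⟩
  exact le_antisymm (ciSup_le hle) (le_ciSup_of_le ⟨_, Set.forall_mem_range.2 hle⟩
    ⟨σ, inferInstance⟩ le_rfl)

lemma Jstar_eq (ρ : Measure X) [IsProbabilityMeasure ρ] : M.Jstar ρ = ∫ x, M.V σ x ∂ρ := by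
  have hle : ∀ π : Policy X A, (haveI := π.2; M.J ρ π.1) ≤ ∫ x, M.V σ x ∂ρ := fun π => by
    have := π.2
    rw [M.J_eq_integral_V π.1 hC]
    exact integral_mono (M.integrable_V π.1 hC ρ) (M.integrable_V σ hC ρ) (hσ π)
  have : Nonempty (Policy X A) := ⟨⟨σ, inferInstance⟩⟩
  exact le_antisymm (ciSup_le hle) (le_ciSup_of_le ⟨_, Set.forall_mem_range.2 hle⟩
    ⟨σ, inferInstance⟩ (M.J_eq_integral_V σ hC ρ).ge)

lemma Q_le_V (x : X) (a : A) : M.Q σ x a ≤ M.V σ x := by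
  obtain ⟨π, hπ, hle⟩ := exists_policy_max_V_Q_le_V (σ := σ) hC a
  exact ((le_max_right _ _).trans (hle x)).trans (hσ ⟨π, hπ⟩ x)

lemma iSup_Qstar_eq (x : X) : ⨆ a, M.Qstar x a = M.V σ x := by
  have : Nonempty A := (σ x).nonempty_of_neZero
  simp only [hσ.Qstar_eq hC]
  have hbdd : BddAbove (Set.range (M.Q σ x)) := ⟨_, Set.forall_mem_range.2 (hσ.Q_le_V hC x)⟩
  refine le_antisymm (ciSup_le (hσ.Q_le_V hC x)) ?_
  calc M.V σ x = ∫ a, M.Q σ x a ∂σ x := M.V_eq_integral_Q σ hC x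
    _ ≤ ∫ _, (⨆ b, M.Q σ x b) ∂σ x := integral_mono
        (integrable_of_abs_le (M.measurable_Q_right σ hC x) (M.abs_Q_le σ hC x))
        (integrable_const _) (le_ciSup hbdd)
    _ = ⨆ b, M.Q σ x b := by simp

theorem Jstar_sub_J (ρ : Measure X) [IsProbabilityMeasure ρ] (π : Kernel X A)
    [IsMarkovKernel π] :
    M.Jstar ρ - M.J ρ π =
      1 / (1 - M.γ) * ∫ x, ((⨆ a, M.Qstar x a) - ∫ a, M.Qstar x a ∂π x) ∂M.occupancy ρ π := by
  rw [hσ.Jstar_eq hC, M.integral_V_sub_J ρ π σ hC]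
  simp only [← hσ.iSup_Qstar_eq hC, ← hσ.Qstar_eq hC]

lemma abs_Qstar_le (x : X) (a : A) : |M.Qstar x a| ≤ C / (1 - M.γ) := by
  rw [hσ.Qstar_eq hC]
  exact M.abs_Q_le σ hC x a

lemma abs_iSup_Qstar_le (x : X) : |⨆ a, M.Qstar x a| ≤ C / (1 - M.γ) := by
  rw [hσ.iSup_Qstar_eq hC]
  exact M.abs_V_le σ hC x

end IsOptimal

end Optimality

end MDP

/-- A family of MDPs whose transition laws, rewards and discount factors depend measurably on the
parameter. -/
structure MDP.IsMeasurableFamily {Θ X A : Type*} [MeasurableSpace Θ] [MeasurableSpace X]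
    [MeasurableSpace A] (M : Θ → MDP X A) : Prop where
  measurable_trans : Measurable fun p : Θ × X × A => (M p.1).trans p.2
  measurable_reward : Measurable fun p : Θ × X × A => (M p.1).reward p.2.1 p.2.2
  measurable_γ : Measurable fun θ => (M θ).γ

namespace MDP.IsMeasurableFamily

variable {Θ X A : Type*} [MeasurableSpace Θ] [MeasurableSpace X] [MeasurableSpace A]
  {M : Θ → MDP X A} (hM : IsMeasurableFamily M) (κ : Kernel (Θ × X) A) [IsMarkovKernel κ]

include hM

lemma measurable_step :
    Measurable fun p : Θ × X × A => (M p.1).step (κ.sectR p.1) p.2 := by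
  let T : Kernel (Θ × X × A) X := ⟨_, hM.measurable_trans⟩
  have : IsMarkovKernel T := ⟨fun p => inferInstanceAs (IsProbabilityMeasure ((M p.1).trans p.2))⟩
  let η : Kernel ((Θ × X × A) × X) A := κ.comap (fun q => (q.1.1, q.2)) (by fun_prop)
  convert (T ⊗ₖ η).measurable using 2 with p
  rw [Kernel.compProd_apply_eq_compProd_sectR, step_apply]
  rfl

lemma measurable_transOp {f : Θ → X × A → ℝ}
    (hf : Measurable fun p : Θ × X × A => f p.1 p.2) :
    Measurable fun p : Θ × X × A => (M p.1).transOp (κ.sectR p.1) (f p.1) p.2 := by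
  let S : Kernel (Θ × X × A) (X × A) := ⟨_, hM.measurable_step κ⟩
  have : IsMarkovKernel S :=
    ⟨fun p => inferInstanceAs (IsProbabilityMeasure ((M p.1).step (κ.sectR p.1) p.2))⟩
  have hf' : Measurable fun z : (Θ × X × A) × X × A => f z.1.1 z.2 :=
    hf.comp (measurable_fst.fst.prodMk measurable_snd)
  exact (hf'.stronglyMeasurable.integral_kernel_prod_right' (κ := S)).measurable

lemma measurable_iterate_transOp_reward (t : ℕ) :
    Measurable fun p : Θ × X × A =>
      ((M p.1).transOp (κ.sectR p.1))^[t] (Function.uncurry (M p.1).reward) p.2 := by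
  induction t with
  | zero => exact hM.measurable_reward
  | succ t ih =>
    simp only [Function.iterate_succ_apply']
    exact hM.measurable_transOp κ
      (f := fun θ => ((M θ).transOp (κ.sectR θ))^[t] (Function.uncurry (M θ).reward)) ih

variable {C : Θ → ℝ} (hC : ∀ θ x a, |(M θ).reward x a| ≤ C θ)

include hC

lemma measurable_Q :
    Measurable fun p : Θ × X × A => (M p.1).Q (κ.sectR p.1) p.2.1 p.2.2 := by
  refine measurable_of_tendsto_metrizable (fun n => ?_) (tendsto_pi_nhds.2 fun p =>
    ((M p.1).hasSum_Q (κ.sectR p.1) (hC p.1) p.2.1 p.2.2).tendsto_sum_nat)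
  exact Finset.measurable_fun_sum _ fun t _ =>
    ((hM.measurable_γ.comp measurable_fst).pow_const t).mul
      (hM.measurable_iterate_transOp_reward κ t)

lemma measurable_V : Measurable fun p : Θ × X => (M p.1).V (κ.sectR p.1) p.2 := by
  simp only [fun θ => (M θ).V_eq_integral_Q (κ.sectR θ) (hC θ)]
  have hQ := (hM.measurable_Q κ hC).comp
    (by fun_prop : Measurable fun z : (Θ × X) × A => (z.1.1, z.1.2, z.2))
  exact (hQ.stronglyMeasurable.integral_kernel_prod_right' (κ := κ)).measurable

variable {ν : Measure Θ} (hb : Integrable (fun θ => C θ / (1 - (M θ).γ)) ν)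
  (ρ : Measure X) [IsProbabilityMeasure ρ]

include hb

lemma integrable_integral_V : Integrable (fun θ => ∫ x, (M θ).V (κ.sectR θ) x ∂ρ) ν :=
  integrable_of_abs_le_of_integrable hb
    (hM.measurable_V κ hC).stronglyMeasurable.integral_prod_right'.measurable
    fun θ => abs_integral_le_of_abs_le ((M θ).abs_V_le _ (hC θ))

lemma integrable_J (π : Kernel X A) [IsMarkovKernel π] :
    Integrable (fun θ => (M θ).J ρ π) ν := by
  simp only [fun θ => (M θ).J_eq_integral_V π (hC θ)]
  simpa only [Kernel.sectR_prodMkLeft] using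
    hM.integrable_integral_V (π.prodMkLeft Θ) hC hb ρ

omit hb

variable {κ} (hκ : ∀ θ, (M θ).IsOptimal (κ.sectR θ))

include hκ

lemma measurable_Qstar : Measurable fun p : Θ × X × A => (M p.1).Qstar p.2.1 p.2.2 := by
  simp only [fun θ => (hκ θ).Qstar_eq (hC θ)]
  exact hM.measurable_Q κ hC

lemma measurable_iSup_Qstar : Measurable fun p : Θ × X => ⨆ a, (M p.1).Qstar p.2 a := by
  simp only [fun θ => (hκ θ).iSup_Qstar_eq (hC θ)]
  exact hM.measurable_V κ hC

include hb

lemma integrable_Jstar : Integrable (fun θ => (M θ).Jstar ρ) ν := by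
  simp only [fun θ => (hκ θ).Jstar_eq (hC θ)]
  exact hM.integrable_integral_V κ hC hb ρ

theorem integral_Jstar_sub_integral_J (π : Kernel X A) [IsMarkovKernel π] :
    (∫ θ, (M θ).Jstar ρ ∂ν) - ∫ θ, (M θ).J ρ π ∂ν =
      ∫ θ, 1 / (1 - (M θ).γ) * ∫ x, ((⨆ a, (M θ).Qstar x a) - ∫ a, (M θ).Qstar x a ∂π x)
        ∂(M θ).occupancy ρ π ∂ν := by
  rw [← integral_sub (hM.integrable_Jstar hC hb ρ hκ) (hM.integrable_J hC hb ρ π)]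
  exact integral_congr_ae (Filter.Eventually.of_forall fun θ => (hκ θ).Jstar_sub_J (hC θ) ρ π)

end MDP.IsMeasurableFamily

section BayesRule

variable {Θ L : Type*} [MeasurableSpace Θ] [MeasurableSpace L] {μ : Measure L} {ν : Measure Θ}
  {κ : Kernel L Θ} {η : Kernel Θ L}

lemma comp_eq_of_compProd_eq_map_swap [SFinite μ] [SFinite ν] [IsSFiniteKernel κ]
    [IsMarkovKernel η] (h : μ ⊗ₘ κ = (ν ⊗ₘ η).map Prod.swap) : κ ∘ₘ μ = ν := by
  rw [← Measure.snd_compProd, h, Measure.snd_map_swap, Measure.fst_compProd]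

lemma integral_integral_of_compProd_eq_map_swap [SFinite μ] [SFinite ν] [IsSFiniteKernel κ]
    [IsSFiniteKernel η] (h : μ ⊗ₘ κ = (ν ⊗ₘ η).map Prod.swap) {f : L × Θ → ℝ}
    (hf : Integrable f (μ ⊗ₘ κ)) :
    ∫ l, ∫ θ, f (l, θ) ∂κ l ∂μ = ∫ θ, ∫ l, f (l, θ) ∂η θ ∂ν := by
  rw [← Measure.integral_compProd hf]
  rw [h] at hf ⊢
  rw [integral_map measurable_swap.aemeasurable hf.aestronglyMeasurable]
  exact Measure.integral_compProd (hf.comp_measurable measurable_swap)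

end BayesRule

section DominatedMeans

variable {Θ A : Type*} [MeasurableSpace Θ] {μ : Measure Θ} {b : Θ → ℝ} {q : Θ → A → ℝ}

lemma abs_integral_le_integral (hb : Integrable b μ) (hqb : ∀ θ a, |q θ a| ≤ b θ) (a : A) :
    |∫ θ, q θ a ∂μ| ≤ ∫ θ, b θ ∂μ :=
  norm_integral_le_of_norm_le (f := fun θ => q θ a) hb
    (Filter.Eventually.of_forall fun θ => hqb θ a)

lemma bddAbove_range_integral (hb : Integrable b μ) (hqb : ∀ θ a, |q θ a| ≤ b θ) :
    BddAbove (Set.range fun a => ∫ θ, q θ a ∂μ) :=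
  ⟨_, Set.forall_mem_range.2 fun a => (le_abs_self _).trans (abs_integral_le_integral hb hqb a)⟩

lemma abs_iSup_integral_le [Nonempty A] (hb : Integrable b μ) (hqb : ∀ θ a, |q θ a| ≤ b θ) :
    |⨆ a, ∫ θ, q θ a ∂μ| ≤ ∫ θ, b θ ∂μ := by
  have hle := fun a => abs_le.1 (abs_integral_le_integral hb hqb a)
  obtain ⟨a₀⟩ := ‹Nonempty A›
  exact abs_le.2 ⟨(hle a₀).1.trans (le_ciSup (bddAbove_range_integral hb hqb) a₀),
    ciSup_le fun a => (hle a).2⟩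

variable [MeasurableSpace A] [SFinite μ] {α : Measure A} [IsProbabilityMeasure α]

lemma integrable_prod_of_abs_le (hb : Integrable b μ) (hq : Measurable fun z : Θ × A => q z.1 z.2)
    (hqb : ∀ θ a, |q θ a| ≤ b θ) : Integrable (fun z : A × Θ => q z.2 z.1) (α.prod μ) :=
  integrable_of_abs_le_of_integrable (hb.comp_snd α) (hq.comp measurable_swap)
    fun z => hqb z.2 z.1

lemma integral_prod_le_iSup_integral (hb : Integrable b μ)
    (hq : Measurable fun z : Θ × A => q z.1 z.2) (hqb : ∀ θ a, |q θ a| ≤ b θ) :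
    ∫ z : A × Θ, q z.2 z.1 ∂α.prod μ ≤ ⨆ a, ∫ θ, q θ a ∂μ := by
  have hint := integrable_prod_of_abs_le (α := α) hb hq hqb
  calc ∫ z : A × Θ, q z.2 z.1 ∂α.prod μ = ∫ a, ∫ θ, q θ a ∂μ ∂α := integral_prod _ hint
    _ ≤ ∫ _, (⨆ a, ∫ θ, q θ a ∂μ) ∂α := integral_mono hint.integral_prod_left
        (integrable_const _) (le_ciSup (bddAbove_range_integral hb hqb))
    _ = ⨆ a, ∫ θ, q θ a ∂μ := by simp

end DominatedMeans

section DominatedCompProd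

variable {L Θ : Type*} [MeasurableSpace L] [MeasurableSpace Θ] {μ : Measure L} [SFinite μ]
  {κ : Kernel L Θ} [IsMarkovKernel κ] {b : Θ → ℝ} {v : Θ → L → ℝ}

lemma integrable_compProd_snd (hb : Integrable b (κ ∘ₘ μ)) :
    Integrable (fun z : L × Θ => b z.2) (μ ⊗ₘ κ) :=
  (Measure.integrable_compProd_snd_iff hb.1).2 hb

lemma integrable_compProd_of_abs_le (hb : Integrable b (κ ∘ₘ μ))
    (hv : Measurable fun p : Θ × L => v p.1 p.2) (hvb : ∀ θ l, |v θ l| ≤ b θ) :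
    Integrable (fun z : L × Θ => v z.2 z.1) (μ ⊗ₘ κ) :=
  integrable_of_abs_le_of_integrable (integrable_compProd_snd hb) (hv.comp measurable_swap)
    fun z => hvb z.2 z.1

end DominatedCompProd

section PosteriorMeans

variable {L Θ A : Type*} [MeasurableSpace L] [MeasurableSpace Θ] [MeasurableSpace A]
  {μ : Measure L} {κ : Kernel L Θ} [IsMarkovKernel κ]
  {π : Kernel L A} [IsMarkovKernel π]
  {b : Θ → ℝ} {v : Θ → L → ℝ} {q : Θ → L → A → ℝ}
  (hb : Integrable b (κ ∘ₘ μ))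
  (hv : Measurable fun p : Θ × L => v p.1 p.2) (hvb : ∀ θ l, |v θ l| ≤ b θ)
  (hq : Measurable fun p : Θ × L × A => q p.1 p.2.1 p.2.2) (hqb : ∀ θ l a, |q θ l a| ≤ b θ)

include hb hv hvb hq hqb

lemma ae_integrable_and_bddAbove_range_integral :
    ∀ᵐ l ∂μ, Integrable (v · l) (κ l) ∧
      Integrable (fun z : A × Θ => q z.2 l z.1) ((π l).prod (κ l)) ∧
      (∀ a, Integrable (q · l a) (κ l)) ∧ BddAbove (Set.range fun a => ∫ θ, q θ l a ∂κ l) := by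
  filter_upwards [Measure.ae_integrable_of_integrable_comp hb] with l hl
  have hql : Measurable fun z : Θ × A => q z.1 l z.2 :=
    hq.comp (by fun_prop : Measurable fun z : Θ × A => (z.1, l, z.2))
  exact ⟨integrable_of_abs_le_of_integrable hl (hv.comp measurable_prodMk_right) (hvb · l),
    integrable_prod_of_abs_le hl hql (hqb · l),
    fun a => integrable_of_abs_le_of_integrable hl (hql.comp measurable_prodMk_right) (hqb · l a),
    bddAbove_range_integral hl (hqb · l)⟩

lemma integral_sub_integral_ae_eq :
    (fun l => ∫ θ, (v θ l - ∫ a, q θ l a ∂π l) ∂κ l) =ᵐ[μ]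
      fun l => (∫ θ, v θ l ∂κ l) - ∫ z : A × Θ, q z.2 l z.1 ∂(π l).prod (κ l) := by
  filter_upwards [ae_integrable_and_bddAbove_range_integral (π := π) hb hv hvb hq hqb]
    with l ⟨hvl, hql, _⟩
  rw [integral_prod_symm _ hql]
  exact integral_sub hvl hql.integral_prod_right

variable [IsFiniteMeasure μ]

lemma integrable_compProd_sub_integral :
    Integrable (fun z : L × Θ => v z.2 z.1 - ∫ a, q z.2 z.1 a ∂π z.1) (μ ⊗ₘ κ) := by
  have hq' : Measurable fun p : (Θ × L) × A => q p.1.1 p.1.2 p.2 :=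
    hq.comp (by fun_prop : Measurable fun p : (Θ × L) × A => (p.1.1, p.1.2, p.2))
  refine (integrable_compProd_of_abs_le hb hv hvb).sub (integrable_compProd_of_abs_le
    (v := fun θ l => ∫ a, q θ l a ∂π l) hb ?_ fun θ l => abs_integral_le_of_abs_le (hqb θ l))
  exact (hq'.stronglyMeasurable.integral_kernel_prod_right' (κ := π.prodMkLeft Θ)).measurable

lemma integrable_integral_sub_integral_prod :
    Integrable (fun l => (∫ θ, v θ l ∂κ l) - ∫ z : A × Θ, q z.2 l z.1 ∂(π l).prod (κ l)) μ :=
  (integrable_integral_of_compProd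
    (integrable_compProd_sub_integral (π := π) hb hv hvb hq hqb)).congr
      (integral_sub_integral_ae_eq hb hv hvb hq hqb)

theorem integral_integral_sub_integral_prod {ν : Measure Θ} [SFinite ν] {η : Kernel Θ L}
    [IsSFiniteKernel η] (hbayes : μ ⊗ₘ κ = (ν ⊗ₘ η).map Prod.swap) :
    ∫ l, ((∫ θ, v θ l ∂κ l) - ∫ z : A × Θ, q z.2 l z.1 ∂(π l).prod (κ l)) ∂μ =
      ∫ θ, ∫ l, (v θ l - ∫ a, q θ l a ∂π l) ∂η θ ∂ν := by
  rw [← integral_congr_ae (integral_sub_integral_ae_eq hb hv hvb hq hqb)]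
  exact integral_integral_of_compProd_eq_map_swap hbayes
    (integrable_compProd_sub_integral hb hv hvb hq hqb)

omit hv hvb

theorem integrable_iSup_integral [StandardBorelSpace A] [Nonempty A] :
    Integrable (fun l => ⨆ a, ∫ θ, q θ l a ∂κ l) μ := by
  have hq' : Measurable fun p : (L × A) × Θ => q p.2 p.1.1 p.1.2 :=
    hq.comp (by fun_prop : Measurable fun p : (L × A) × Θ => (p.2, p.1.1, p.1.2))
  have hmean : Measurable fun p : L × A => ∫ θ, q θ p.1 p.2 ∂κ p.1 :=
    (hq'.stronglyMeasurable.integral_kernel_prod_right' (κ := κ.prodMkRight A)).measurable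
  have hbl := Measure.ae_integrable_of_integrable_comp hb
  refine (integrable_integral_of_compProd (integrable_compProd_snd hb)).mono'
    (aemeasurable_iSup_of_standardBorel hmean ?_).aestronglyMeasurable ?_
  · filter_upwards [hbl] with l hl using bddAbove_range_integral hl (hqb · l)
  · filter_upwards [hbl] with l hl using abs_iSup_integral_le hl (hqb · l)

include hv hvb

lemma integrable_integral_sub_iSup_integral [StandardBorelSpace A] [Nonempty A] :
    Integrable (fun l => (∫ θ, v θ l ∂κ l) - ⨆ a, ∫ θ, q θ l a ∂κ l) μ :=
  (integrable_integral_of_compProd (integrable_compProd_of_abs_le hb hv hvb)).sub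
    (integrable_iSup_integral hb hq hqb)

lemma integral_integral_sub_iSup_integral_le [StandardBorelSpace A] [Nonempty A] :
    ∫ l, ((∫ θ, v θ l ∂κ l) - ⨆ a, ∫ θ, q θ l a ∂κ l) ∂μ ≤
      ∫ l, ((∫ θ, v θ l ∂κ l) - ∫ z : A × Θ, q z.2 l z.1 ∂(π l).prod (κ l)) ∂μ := by
  refine integral_mono_ae (integrable_integral_sub_iSup_integral hb hv hvb hq hqb)
    (integrable_integral_sub_integral_prod hb hv hvb hq hqb) ?_
  filter_upwards [Measure.ae_integrable_of_integrable_comp hb] with l hl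
  exact sub_le_sub_left (integral_prod_le_iSup_integral hl
    (hq.comp (by fun_prop : Measurable fun z : Θ × A => (z.1, l, z.2))) (hqb · l)) _

end PosteriorMeans

lemma TaskDistribution.isMeasurableFamily_augment {Θ S A : Type*} [MeasurableSpace Θ]
    [MeasurableSpace S] [MeasurableSpace A] (𝒯 : TaskDistribution Θ S A)
    (π : Kernel (PartialTraj S A) A) [IsMarkovKernel π] :
    MDP.IsMeasurableFamily fun θ => (𝒯.task θ).augment where
  measurable_trans := by
    convert ((𝒯.jointStep π).map Prod.fst).measurable using 2 with p
    rw [Kernel.map_apply _ measurable_fst, jointStep_apply, MDP.step_apply]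
    exact (Measure.fst_compProd _ _).symm
  measurable_reward := by
    have := PartialTraj.measurable_last (S := S) (A := A)
    exact 𝒯.measurable_reward.comp (by fun_prop :
      Measurable fun p : Θ × PartialTraj S A × A => (p.1, p.2.1.last, p.2.2))
  measurable_γ := measurable_const

theorem theorem4_general {Θ X A : Type*} [MeasurableSpace Θ] [MeasurableSpace X]
    [MeasurableSpace A] [StandardBorelSpace A]
    {M : Θ → MDP X A} (hM : MDP.IsMeasurableFamily M) {γ : ℝ} (hγ : ∀ θ, (M θ).γ = γ)
    (prior : Measure Θ) [IsProbabilityMeasure prior] (ρ : Measure X) [IsProbabilityMeasure ρ]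
    (B : Θ → ℝ) (hB : Integrable B prior) (hR : ∀ θ x a, |(M θ).reward x a| ≤ B θ)
    (πstar : Kernel (Θ × X) A) [IsMarkovKernel πstar]
    (hπstar : ∀ θ, (M θ).IsOptimal (πstar.sectR θ))
    (π : Kernel X A) [IsMarkovKernel π]
    (occ : Kernel Θ X) [IsMarkovKernel occ] (hocc : ∀ θ, occ θ = (M θ).occupancy ρ π)
    (post : Kernel X Θ) [IsMarkovKernel post]
    (hpost : (occ ∘ₘ prior) ⊗ₘ post = (prior ⊗ₘ occ).map Prod.swap) :
    (Integrable (fun θ => (M θ).Jstar ρ) prior ∧ Integrable (fun θ => (M θ).J ρ π) prior ∧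
      (∀ᵐ x ∂(occ ∘ₘ prior),
        Integrable (fun θ => ⨆ a, (M θ).Qstar x a) (post x) ∧
        Integrable (fun z : A × Θ => (M z.2).Qstar x z.1) ((π x).prod (post x)) ∧
        (∀ a, Integrable (fun θ => (M θ).Qstar x a) (post x)) ∧
        BddAbove (Set.range fun a => ∫ θ, (M θ).Qstar x a ∂post x)) ∧
      Integrable (fun x =>
        (∫ θ, ⨆ a, (M θ).Qstar x a ∂post x) -
          ∫ z : A × Θ, (M z.2).Qstar x z.1 ∂((π x).prod (post x)))
        (occ ∘ₘ prior) ∧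
      Integrable (fun x =>
        (∫ θ, ⨆ a, (M θ).Qstar x a ∂post x) - ⨆ a, ∫ θ, (M θ).Qstar x a ∂post x)
        (occ ∘ₘ prior)) ∧
    (∫ θ, (M θ).Jstar ρ ∂prior) - ∫ θ, (M θ).J ρ π ∂prior =
      1 / (1 - γ) * ∫ x,
        ((∫ θ, ⨆ a, (M θ).Qstar x a ∂post x) -
          ∫ z : A × Θ, (M z.2).Qstar x z.1 ∂((π x).prod (post x)))
        ∂(occ ∘ₘ prior) ∧
    (∫ θ, (M θ).Jstar ρ ∂prior) - ∫ θ, (M θ).J ρ π ∂prior ≥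
      1 / (1 - γ) * ∫ x,
        ((∫ θ, ⨆ a, (M θ).Qstar x a ∂post x) - ⨆ a, ∫ θ, (M θ).Qstar x a ∂post x)
        ∂(occ ∘ₘ prior) := by
  obtain ⟨x₀⟩ : Nonempty X := ρ.nonempty_of_neZero
  have : Nonempty A := (π x₀).nonempty_of_neZero
  obtain ⟨θ₀⟩ : Nonempty Θ := prior.nonempty_of_neZero
  have hb : Integrable (fun θ => B θ / (1 - (M θ).γ)) prior := by
    simpa only [hγ] using hB.div_const (1 - γ)
  have hb' : Integrable (fun θ => B θ / (1 - (M θ).γ)) (post ∘ₘ occ ∘ₘ prior) := by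
    rwa [comp_eq_of_compProd_eq_map_swap hpost]
  let q : Θ → X → A → ℝ := fun θ => (M θ).Qstar
  let v : Θ → X → ℝ := fun θ x => ⨆ a, (M θ).Qstar x a
  have hv : Measurable fun p : Θ × X => v p.1 p.2 := hM.measurable_iSup_Qstar hR hπstar
  have hvb := fun θ => (hπstar θ).abs_iSup_Qstar_le (hR θ)
  have hq : Measurable fun p : Θ × X × A => q p.1 p.2.1 p.2.2 := hM.measurable_Qstar hR hπstar
  have hqb := fun θ => (hπstar θ).abs_Qstar_le (hR θ)
  have hformula : (∫ θ, (M θ).Jstar ρ ∂prior) - ∫ θ, (M θ).J ρ π ∂prior =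
      1 / (1 - γ) * ∫ x, ((∫ θ, v θ x ∂post x) -
        ∫ z : A × Θ, q z.2 x z.1 ∂((π x).prod (post x))) ∂(occ ∘ₘ prior) := by
    rw [hM.integral_Jstar_sub_integral_J hR hb ρ hπstar π,
      integral_integral_sub_integral_prod hb' hv hvb hq hqb hpost, ← integral_const_mul]
    simp only [hγ, hocc, v, q]
  have hae := ae_integrable_and_bddAbove_range_integral (π := π) hb' hv hvb hq hqb
  have hgap := integrable_integral_sub_integral_prod (π := π) hb' hv hvb hq hqb
  have hbound := integrable_integral_sub_iSup_integral hb' hv hvb hq hqb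
  have hle := integral_integral_sub_iSup_integral_le (π := π) hb' hv hvb hq hqb
  have hγ₀ : 0 ≤ 1 / (1 - γ) := one_div_nonneg.2 (by simpa only [hγ] using (M θ₀).one_sub_γ_pos.le)
  exact ⟨⟨hM.integrable_Jstar hR hb ρ hπstar, hM.integrable_J hR hb ρ π, hae, hgap, hbound⟩,
    hformula, (mul_le_mul_of_nonneg_left hle hγ₀).trans_eq hformula.symm⟩

theorem theorem4 {Θ S A : Type*}
    [MeasurableSpace Θ] [StandardBorelSpace Θ] [Nonempty Θ]
    [MeasurableSpace S] [StandardBorelSpace S]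
    [MeasurableSpace A] [StandardBorelSpace A]
    (𝒯 : TaskDistribution Θ S A)
    -- rewards are bounded in each task, with bounds integrable over the task distribution
    (B : Θ → ℝ) (hB : Integrable B 𝒯.prior)
    (hR : ∀ θ s a, |𝒯.reward θ s a| ≤ B θ)
    -- every task has an optimal policy, chosen measurably in the task
    (πstar : Kernel (Θ × PartialTraj S A) A) [IsMarkovKernel πstar]
    (hπstar : ∀ θ, (𝒯.task θ).augment.IsOptimal (πstar.sectR θ))
    (π : Kernel (PartialTraj S A) A) [IsMarkovKernel π] :
    -- all the expectations below are well defined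
    (Integrable 𝒯.Jstar 𝒯.prior ∧ Integrable (𝒯.J π) 𝒯.prior ∧
      (∀ᵐ l ∂𝒯.trajDist π,
        Integrable (fun θ => ⨆ a, 𝒯.Qstar θ l a) (𝒯.taskPosterior π l) ∧
        Integrable (fun x : A × Θ => 𝒯.Qstar x.2 l x.1) ((π l).prod (𝒯.taskPosterior π l)) ∧
        (∀ a, Integrable (fun θ => 𝒯.Qstar θ l a) (𝒯.taskPosterior π l)) ∧
        BddAbove (Set.range fun a => ∫ θ, 𝒯.Qstar θ l a ∂𝒯.taskPosterior π l)) ∧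
      Integrable (fun l =>
        (∫ θ, ⨆ a, 𝒯.Qstar θ l a ∂𝒯.taskPosterior π l) -
          ∫ x : A × Θ, 𝒯.Qstar x.2 l x.1 ∂((π l).prod (𝒯.taskPosterior π l)))
        (𝒯.trajDist π) ∧
      Integrable (fun l =>
        (∫ θ, ⨆ a, 𝒯.Qstar θ l a ∂𝒯.taskPosterior π l) -
          ⨆ a, ∫ θ, 𝒯.Qstar θ l a ∂𝒯.taskPosterior π l)
        (𝒯.trajDist π)) ∧
    -- the exact formula for the optimality gap
    (∫ θ, 𝒯.Jstar θ ∂𝒯.prior) - ∫ θ, 𝒯.J π θ ∂𝒯.prior =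
      1 / (1 - 𝒯.γ) * ∫ l,
        ((∫ θ, ⨆ a, 𝒯.Qstar θ l a ∂𝒯.taskPosterior π l) -
          ∫ x : A × Θ, 𝒯.Qstar x.2 l x.1 ∂((π l).prod (𝒯.taskPosterior π l)))
        ∂𝒯.trajDist π ∧
    -- the lower bound
    (∫ θ, 𝒯.Jstar θ ∂𝒯.prior) - ∫ θ, 𝒯.J π θ ∂𝒯.prior ≥
      1 / (1 - 𝒯.γ) * ∫ l,
        ((∫ θ, ⨆ a, 𝒯.Qstar θ l a ∂𝒯.taskPosterior π l) -
          ⨆ a, ∫ θ, 𝒯.Qstar θ l a ∂𝒯.taskPosterior π l)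
        ∂𝒯.trajDist π := by
  exact theorem4_general (𝒯.isMeasurableFamily_augment π) (fun _ => rfl) 𝒯.prior 𝒯.augInit B hB
    (fun θ l a => hR θ l.last a) πstar hπstar π (𝒯.occupancy π) (fun _ => rfl)
    (posterior (𝒯.occupancy π) 𝒯.prior) compProd_posterior_eq_map_swap
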